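/- Let $n, k, r$ be integers with $n \ge 1$, $0 \le k \le n$ and $r \ge 2$. Work with monomials $x_1^{a_1}\cdots x_n^{a_n}$ in $\mathbb{C}[x_1,\dots,x_n]$. For a subset $S=\{s_1<\cdots<s_m\}\subseteq\{1,\dots,n\}$, the skip monomial is $\mathbf{x}(S) := x_{s_1}^{s_1}x_{s_2}^{s_2-1}\cdots x_{s_m}^{s_m-m+1}$. Let $\mathcal{M}_{n,k}$ be the set of $(n,k)$-nonskip monomials, that is, of monomials $m$ such that $x_i^{kr+1}\nmid m$ for $1\le i\le n$ and $\mathbf{x}(S)^r\nmid m$ for all $S\subseteq\{1,\dots,n\}$ with $|S|=n-k+1$. Let $\mathcal{N}_{n,k}$ be the set of strongly $(n,k)$-nonskip monomials, that is, of those $m\in\mathcal{M}_{n,k}$ such that $x_i^{kr}\nmid m$ for $1\le i\le n$. A shuffle of two sequences $(a_1,\dots,a_p)$ and $(b_1,\dots,b_q)$ is an interleaving $(c_1,\dots,c_{p+q})$ of them that preserves the relative order of the $a$'s and of the $b$'s. Then $$\mathcal{M}_{n,k}=\left\{x_1^{a_1}\cdots x_n^{a_n} : (a_1,\dots,a_n)\text{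 is componentwise}\le\text{some shuffle of }(r-1,2r-1,\dots,kr-1)\text{ and }(\underbrace{kr,\dots,kr}_{n-k})\right\}$$ and $$\mathcal{N}_{n,k}=\left\{x_1^{a_1}\cdots x_n^{a_n} : (a_1,\dots,a_n)\text{ is componentwise}\le\text{some shuffle of }(r-1,2r-1,\dots,kr-1)\text{ and }(\underbrace{kr-1,\dots,kr-1}_{n-k})\right\}.$$ -/

import Mathlib

open MvPolynomial

noncomputable section

/-- The skip monomial `x(S) = x_{s₁}^{s₁} x_{s₂}^{s₂ - 1} ⋯ x_{s_m}^{s_m - m + 1}` of a set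
`S = {s₁ < ⋯ < s_m} ⊆ [n]`, as a polynomial in `ℂ[x₁, …, x_n]`. The variable `x_{i+1}` is `X i` for
`i : Fin n`. If `s_j = i + 1`, then `j - 1` is the number of elements of `S` below `i`, so
`s_j - j + 1 = (i + 1) - #{t ∈ S | t < i}`; this subtraction never truncates. -/
def skipMonomial {n : ℕ} (S : Finset (Fin n)) : MvPolynomial (Fin n) ℂ :=
  ∏ i ∈ S, X i ^ ((i : ℕ) + 1 - (S.filter (fun t => t < i)).card)

/-- `p` is a monomial `x₁^{a₁} ⋯ x_n^{a_n}` (with coefficient `1`). -/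
def IsMonomialPoly {n : ℕ} (p : MvPolynomial (Fin n) ℂ) : Prop :=
  ∃ a : Fin n →₀ ℕ, p = monomial a 1

/-- The set `M_{n,k}` of `(n,k)`-nonskip monomials in `ℂ[x₁, …, x_n]`
(used for `k ≤ n`, so that `n - k` is the true difference). -/
def nonskipMonomials (n k r : ℕ) : Set (MvPolynomial (Fin n) ℂ) :=
  {m | IsMonomialPoly m ∧ (∀ i : Fin n, ¬ X i ^ (k * r + 1) ∣ m) ∧
    ∀ S : Finset (Fin n), S.card = n - k + 1 → ¬ skipMonomial S ^ r ∣ m}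

/-- The set `N_{n,k}` of strongly `(n,k)`-nonskip monomials in `ℂ[x₁, …, x_n]`. -/
def stronglyNonskipMonomials (n k r : ℕ) : Set (MvPolynomial (Fin n) ℂ) :=
  {m | m ∈ nonskipMonomials n k r ∧ ∀ i : Fin n, ¬ X i ^ (k * r) ∣ m}

/-- `c` is a shuffle of the sequences `a` and `b`: the positions of `c` are partitioned into the
range of an increasing `f`, along which `c` reads `a`, and the range of an increasing `g`, along
which `c` reads `b`. -/
def IsShuffle {α : Type*} {p q n : ℕ} (a : Fin p → α) (b : Fin q → α) (c : Fin n → α) : Prop :=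
  ∃ (f : Fin p ↪o Fin n) (g : Fin q ↪o Fin n),
    IsCompl (Set.range f) (Set.range g) ∧ (∀ i, c (f i) = a i) ∧ (∀ j, c (g j) = b j)

/-- The sequence `(r - 1, 2r - 1, …, kr - 1)` of integers. -/
def staircase (k r : ℕ) : Fin k → ℤ := fun j => ((j : ℤ) + 1) * (r : ℤ) - 1

/-- The monomials `x₁^{a₁} ⋯ x_n^{a_n}` whose exponent sequence is componentwise `≤` some shuffle of
`(r - 1, 2r - 1, …, kr - 1)` and `(v, …, v)`, with `n - k` copies of `v`. -/
def belowShuffleMonomials (n k r : ℕ) (v : ℤ) : Set (MvPolynomial (Fin n) ℂ) :=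
  {m | ∃ a : Fin n →₀ ℕ, m = monomial a 1 ∧
    ∃ c : Fin n → ℤ, IsShuffle (staircase k r) (fun _ : Fin (n - k) => v) c ∧
      ∀ i, (a i : ℤ) ≤ c i}

end

/-! Everything reduces to counting. For `i ∈ S` the exponent of `x(S)` at `i` is one more than the
number of elements of `Sᶜ` below `i`. A shuffle is a `k`-set `F` of staircase positions, requiring
`a i < (#{t ∈ F | t < i} + 1) * r` on `F`. If such an `F` exists, every `S` of size `n - k + 1`
meets it, and the least common element violates the skip condition of `S`. Conversely, a largest
valid `F` with fewer than `k` elements would yield a forbidden `S`: an initial segment of `Fᶜ`. -/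

open Finset in
/-- Every finite set of size at least `m` has an initial segment of size `m`. -/
theorem exists_initial_subset_card_eq {α : Type*} [LinearOrder α] (T : Finset α) (m : ℕ)
    (hm : m ≤ #T) : ∃ S ⊆ T, #S = m ∧ ∀ i ∈ S, ∀ t ∈ T, t < i → t ∈ S := by
  induction m with
  | zero => exact ⟨∅, by simp, by simp, by simp⟩
  | succ m ih =>
    obtain ⟨S, hST, hS, hinit⟩ := ih (by omega)
    have hne : (T \ S).Nonempty := by
      rw [← card_pos, card_sdiff_of_subset hST]
      omega
    have hmin := mem_sdiff.1 (min'_mem (T \ S) hne)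
    refine ⟨insert ((T \ S).min' hne) S, insert_subset hmin.1 hST, ?_, ?_⟩
    · rw [card_insert_of_notMem hmin.2, hS]
    · intro i hi t ht hti
      by_contra hcon
      simp only [mem_insert, not_or] at hcon hi
      rcases hi with rfl | hi
      · exact absurd hti (not_lt.2 (min'_le _ _ (mem_sdiff.2 ⟨ht, hcon.2⟩)))
      · exact hcon.2 (hinit i hi t ht hti)

-- With zero-based indices, exactly `i` elements lie below `i`, split between `S` and `Sᶜ`.
open Finset in
theorem val_add_one_sub_card_filter_lt {n : ℕ} (S : Finset (Fin n)) (i : Fin n) :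
    (i : ℕ) + 1 - #{t ∈ S | t < i} = #{t ∈ Sᶜ | t < i} + 1 := by
  have hcard : #{t ∈ S | t < i} + #{t ∈ Sᶜ | t < i} = i := by
    rw [← card_union_of_disjoint (disjoint_filter_filter disjoint_compl_right),
      ← filter_union, union_compl, ← Fin.card_Iio i]
    congr 1
    ext t
    simp
  omega

theorem skipMonomial_pow_eq_monomial {n : ℕ} (S : Finset (Fin n)) (r : ℕ) :
    skipMonomial S ^ r = monomial
      (∑ i ∈ S, Finsupp.single i (((Sᶜ.filter (fun t => t < i)).card + 1) * r)) 1 := by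
  classical
  rw [monomial_sum_one, skipMonomial, ← Finset.prod_pow]
  refine Finset.prod_congr rfl fun i _ => ?_
  rw [val_add_one_sub_card_filter_lt, ← pow_mul, X_pow_eq_monomial]

theorem skipMonomial_pow_dvd_monomial_iff {n : ℕ} (S : Finset (Fin n)) (r : ℕ) (a : Fin n →₀ ℕ) :
    skipMonomial S ^ r ∣ monomial a (1 : ℂ) ↔
      ∀ i ∈ S, ((Sᶜ.filter (fun t => t < i)).card + 1) * r ≤ a i := by
  classical
  rw [skipMonomial_pow_eq_monomial, monomial_dvd_monomial]
  simp only [one_ne_zero, false_or, dvd_refl, and_true, Finsupp.le_def, Finsupp.finsetSum_apply,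
    Finsupp.single_apply, Finset.sum_ite_eq']
  refine forall_congr' fun i => ?_
  split_ifs with h <;> simp [h]

theorem X_pow_dvd_monomial_iff {n : ℕ} (i : Fin n) (e : ℕ) (a : Fin n →₀ ℕ) :
    (X i : MvPolynomial (Fin n) ℂ) ^ e ∣ monomial a 1 ↔ e ≤ a i := by
  rw [X_pow_eq_monomial, monomial_dvd_monomial]
  simp

open Finset in
theorem card_filter_lt_orderEmb {k n : ℕ} (f : Fin k ↪o Fin n) (F : Finset (Fin n))
    (hF : ∀ i, i ∈ F ↔ i ∈ Set.range f) (j : Fin k) : #{t ∈ F | t < f j} = j := by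
  rw [← Fin.card_Iio j, ← card_map f.toEmbedding]
  congr 1
  ext t
  simp only [mem_filter, hF, Set.mem_range, mem_map, mem_Iio, RelEmbedding.coe_toEmbedding]
  constructor
  · rintro ⟨⟨y, rfl⟩, h⟩
    exact ⟨y, f.lt_iff_lt.1 h, rfl⟩
  · rintro ⟨y, h, rfl⟩
    exact ⟨⟨y, rfl⟩, f.lt_iff_lt.2 h⟩

open Finset in
/-- A sequence lies below a shuffle of the staircase and a constant sequence iff it does so for
some choice `F` of the positions occupied by the staircase. -/
theorem exists_isShuffle_staircase_iff {n k : ℕ} (r : ℕ) (v : ℤ) (a : Fin n → ℕ) :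
    (∃ c : Fin n → ℤ, IsShuffle (staircase k r) (fun _ : Fin (n - k) => v) c ∧
      ∀ i, (a i : ℤ) ≤ c i) ↔
    ∃ F : Finset (Fin n), #F = k ∧ (∀ i ∈ F, a i < (#{t ∈ F | t < i} + 1) * r) ∧
      ∀ i ∉ F, (a i : ℤ) ≤ v := by
  constructor
  · rintro ⟨c, ⟨f, g, hfg, hf, hg⟩, hac⟩
    have hF : ∀ i, i ∈ univ.map f.toEmbedding ↔ i ∈ Set.range f := by simp
    refine ⟨univ.map f.toEmbedding, by simp, ?_, ?_⟩
    · intro i hi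
      obtain ⟨j, rfl⟩ := (hF i).1 hi
      rw [card_filter_lt_orderEmb f _ hF]
      have h := hac (f j)
      rw [hf, staircase] at h
      zify
      linarith
    · intro i hi
      rw [hF] at hi
      obtain ⟨j, rfl⟩ : i ∈ Set.range g := by
        rw [← hfg.compl_eq]
        exact hi
      exact (hac _).trans_eq (hg j)
  · rintro ⟨F, hF, hlt, hle⟩
    have hFc : #Fᶜ = n - k := by rw [card_compl, hF, Fintype.card_fin]
    have hcard := card_filter_lt_orderEmb (F.orderEmbOfFin hF) F (by simp)
    refine ⟨fun i => if i ∈ F then ((#{t ∈ F | t < i} : ℤ) + 1) * r - 1 else v,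
      ⟨F.orderEmbOfFin hF, Fᶜ.orderEmbOfFin hFc, ?_, ?_, ?_⟩, ?_⟩
    · rw [range_orderEmbOfFin, range_orderEmbOfFin, coe_compl]
      exact isCompl_compl
    · intro j
      dsimp only
      rw [if_pos (orderEmbOfFin_mem _ _ _), hcard, staircase]
    · intro j
      dsimp only
      rw [if_neg (mem_compl.1 (orderEmbOfFin_mem _ _ _))]
    · intro i
      dsimp only
      split_ifs with h
      · have := hlt i h
        zify at this
        linarith
      · exact hle i h

open Finset in
/-- If a set `F` of staircase positions works for `a`, then no skip condition holds for `a`. -/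
theorem not_forall_mem_le_of_staircase {n k r : ℕ} (hk : k ≤ n) {a : Fin n → ℕ}
    {F : Finset (Fin n)} (hF : #F = k) (hlt : ∀ i ∈ F, a i < (#{t ∈ F | t < i} + 1) * r)
    {S : Finset (Fin n)} (hS : #S = n - k + 1) :
    ¬ ∀ i ∈ S, (#{t ∈ Sᶜ | t < i} + 1) * r ≤ a i := by
  intro h
  have hne : (F ∩ S).Nonempty := by
    by_contra hcon
    have hle := card_le_univ (F ∪ S)
    rw [card_union_of_disjoint (disjoint_iff_inter_eq_empty.2 (not_nonempty_iff_eq_empty.1 hcon)),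
      Fintype.card_fin] at hle
    omega
  -- By minimality, every element of `F` below `i` avoids `S`.
  set i := (F ∩ S).min' hne
  have hi := mem_inter.1 (min'_mem _ hne)
  have hsub : {t ∈ F | t < i} ⊆ {t ∈ Sᶜ | t < i} := by
    intro t ht
    rw [mem_filter] at ht
    refine mem_filter.2 ⟨mem_compl.2 fun hts => ?_, ht.2⟩
    exact absurd ht.2 (not_lt.2 (min'_le _ _ (mem_inter.2 ⟨ht.1, hts⟩)))
  have hcard := Nat.mul_le_mul_right r (Nat.add_le_add_right (card_le_card hsub) 1)
  exact absurd (hlt i hi.1) (not_lt.2 (hcard.trans (h i hi.2)))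

open Finset in
/-- If no skip condition holds for `a`, then some set of staircase positions works for `a`. -/
theorem exists_staircase_positions {n k r : ℕ} (hk : k ≤ n) {a : Fin n → ℕ}
    (h : ∀ S : Finset (Fin n), #S = n - k + 1 → ¬ ∀ i ∈ S, (#{t ∈ Sᶜ | t < i} + 1) * r ≤ a i) :
    ∃ F : Finset (Fin n), #F = k ∧ ∀ i ∈ F, a i < (#{t ∈ F | t < i} + 1) * r := by
  classical
  obtain ⟨F, hF, hmax⟩ := exists_max_image
    (univ.filter fun F : Finset (Fin n) =>
      #F ≤ k ∧ ∀ i ∈ F, a i < (#{t ∈ F | t < i} + 1) * r) card ⟨∅, by simp⟩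
  simp only [mem_filter, mem_univ, true_and] at hF hmax
  refine ⟨F, hF.1.antisymm (not_lt.1 fun hlt => ?_), hF.2⟩
  have hge : ∀ i ∉ F, (#{t ∈ F | t < i} + 1) * r ≤ a i := by
    intro i hi
    by_contra! hcon
    -- Enlarging `F` only relaxes the bounds, so `insert i F` would stay valid, against maximality.
    have hmono : ∀ j, (#{t ∈ F | t < j} + 1) * r ≤ (#{t ∈ insert i F | t < j} + 1) * r := by
      intro j
      gcongr
      exact subset_insert i F
    have hle := hmax (insert i F) ⟨by rw [card_insert_of_notMem hi]; omega, fun j hj => by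
      rcases mem_insert.1 hj with rfl | hj
      · exact hcon.trans_le (hmono _)
      · exact (hF.2 j hj).trans_le (hmono j)⟩
    rw [card_insert_of_notMem hi] at hle
    omega
  obtain ⟨S, hSF, hS, hinit⟩ := exists_initial_subset_card_eq Fᶜ (n - k + 1) (by
    rw [card_compl, Fintype.card_fin]
    omega)
  refine h S hS fun i hi => ?_
  -- Since `S` is initial in `Fᶜ`, below `i ∈ S` the complement of `S` is just `F`.
  have heq : {t ∈ Sᶜ | t < i} = {t ∈ F | t < i} := by
    ext t
    simp only [mem_filter, mem_compl, and_congr_left_iff]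
    refine fun hti => ⟨fun hts => ?_, fun htF hts => mem_compl.1 (hSF hts) htF⟩
    by_contra htF
    exact hts (hinit i hi t (mem_compl.2 htF) hti)
  rw [heq]
  exact hge i (mem_compl.1 (hSF hi))

open Finset in
theorem lt_mul_of_staircase {n k r : ℕ} {a : Fin n → ℕ} {F : Finset (Fin n)}
    (hF : #F = k) {i : Fin n} (hi : i ∈ F) (hlt : a i < (#{t ∈ F | t < i} + 1) * r) :
    a i < k * r := by
  have hcard : #{t ∈ F | t < i} < #F :=
    card_lt_card ((filter_ssubset).2 ⟨i, hi, lt_irrefl i⟩)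
  rw [hF] at hcard
  exact hlt.trans_le (Nat.mul_le_mul_right r hcard)

-- By `hv` no staircase entry exceeds `v`, so the bound by `v` holds at all positions and decouples
-- from the choice of `F`.
open Finset in
theorem mem_belowShuffleMonomials_iff {n k : ℕ} (r : ℕ) (hk : k ≤ n) {v : ℤ}
    (hv : (k : ℤ) * r - 1 ≤ v) (a : Fin n →₀ ℕ) :
    monomial a 1 ∈ belowShuffleMonomials n k r v ↔
      (∀ i, (a i : ℤ) ≤ v) ∧ ∀ S : Finset (Fin n), #S = n - k + 1 →
        ¬ ∀ i ∈ S, (#{t ∈ Sᶜ | t < i} + 1) * r ≤ a i := by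
  have hmem : monomial a 1 ∈ belowShuffleMonomials n k r v ↔
      ∃ c : Fin n → ℤ, IsShuffle (staircase k r) (fun _ : Fin (n - k) => v) c ∧
        ∀ i, (a i : ℤ) ≤ c i := by
    constructor
    · rintro ⟨b, hb, hc⟩
      rwa [monomial_left_injective one_ne_zero hb]
    · exact fun hc => ⟨a, rfl, hc⟩
  rw [hmem, exists_isShuffle_staircase_iff r]
  constructor
  · rintro ⟨F, hF, hlt, hle⟩
    refine ⟨fun i => ?_, fun S hS => not_forall_mem_le_of_staircase hk hF hlt hS⟩
    by_cases hi : i ∈ F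
    · have := lt_mul_of_staircase hF hi (hlt i hi)
      zify at this
      linarith
    · exact hle i hi
  · rintro ⟨hle, h⟩
    obtain ⟨F, hF, hlt⟩ := exists_staircase_positions hk h
    exact ⟨F, hF, hlt, fun i _ => hle i⟩

theorem monomial_mem_nonskipMonomials_iff {n : ℕ} (k r : ℕ) (a : Fin n →₀ ℕ) :
    monomial a 1 ∈ nonskipMonomials n k r ↔
      (∀ i, (a i : ℤ) ≤ (k : ℤ) * r) ∧ ∀ S : Finset (Fin n), S.card = n - k + 1 →
        ¬ ∀ i ∈ S, ((Sᶜ.filter (fun t => t < i)).card + 1) * r ≤ a i := by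
  have hX : ∀ i, ¬ k * r + 1 ≤ a i ↔ (a i : ℤ) ≤ (k : ℤ) * r := by
    intro i
    rw [not_le, Nat.lt_succ_iff]
    zify
  simp only [nonskipMonomials, Set.mem_ofPred_eq, X_pow_dvd_monomial_iff,
    skipMonomial_pow_dvd_monomial_iff, hX]
  exact and_iff_right ⟨a, rfl⟩

theorem mainTheorem4 (n k r : ℕ) (hn : 1 ≤ n) (hk : k ≤ n) (hr : 2 ≤ r) :
    nonskipMonomials n k r = belowShuffleMonomials n k r ((k : ℤ) * (r : ℤ)) ∧
    stronglyNonskipMonomials n k r =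
      belowShuffleMonomials n k r ((k : ℤ) * (r : ℤ) - 1) := by
  constructor
  · ext m
    by_cases hm : IsMonomialPoly m
    · obtain ⟨a, rfl⟩ := hm
      rw [monomial_mem_nonskipMonomials_iff, mem_belowShuffleMonomials_iff r hk (by linarith)]
    · exact iff_of_false (fun h => hm h.1) fun ⟨a, ha, _⟩ => hm ⟨a, ha⟩
  · ext m
    by_cases hm : IsMonomialPoly m
    · obtain ⟨a, rfl⟩ := hm
      -- For `k = 0` the integer bound is `-1`, and both sides are false.
      have hX : ∀ i, ¬ k * r ≤ a i ↔ (a i : ℤ) ≤ (k : ℤ) * r - 1 := by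
        intro i
        rw [not_le, Int.le_sub_one_iff]
        zify
      rw [mem_belowShuffleMonomials_iff r hk le_rfl, stronglyNonskipMonomials, Set.mem_ofPred_eq,
        monomial_mem_nonskipMonomials_iff]
      simp only [X_pow_dvd_monomial_iff, hX]
      exact ⟨fun h => ⟨h.2, h.1.2⟩,
        fun h => ⟨⟨fun i => (h.1 i).trans (by linarith), h.2⟩, h.1⟩⟩
    · exact iff_of_false (fun h => hm h.1.1) fun ⟨a, ha, _⟩ => hm ⟨a, ha⟩
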